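/- **Theorem 1.** Consider a platoon of a leader, numbered $0$, and $N\ge 1$ followers, numbered $1,\dots,N$. Vehicle $i$ has state $x_i=(p_i,v_i,a_i)^T$ (position, velocity, acceleration) and obeys on $[0,\infty)$ $$\dot p_i=v_i,\qquad \dot v_i=a_i,\qquad \tau_i\dot a_i+a_i=u_i,$$ with time lags $\tau_i>0$ that may differ from vehicle to vehicle. Its output is $y_i=Cx_i$, $C=\mathrm{diag}(c_p,c_v,c_a)$ with $c_p,c_v,c_a\in\{0,1\}$. The followers use the static diffusive controller $$u_i=-k_i^T\sum_{j=1}^N a_{ij}(y_i-y_j-\hat d_{i,j})-p_{ii}k_i^T(y_i-y_0-\hat d_{i,0}),\qquad \hat d_{i,j}=(-(i-j)d_0,0,0)^T,$$ where $d_0\in\mathbb R$, the gains $k_i\in\mathbb R^3$ are arbitrary, $(a_{ij})\in\{0,1\}^{N\times N}$ is the adjacency matrix of an arbitrary directed graph without self-loops on the followers ($a_{ij}=1$ if $i$ receives information from $j$), and $p_{ii}\in\{0,1\}$ indicates whether follower $i$ receives information from the leader. The motion of the leader is generated by an autonomous linear system: $x_0(t)=Hw(t)$, $\dot w=Sw$,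 for some real matrices $S\in\mathbb R^{m\times m}$, $H\in\mathbb R^{3\times m}$ (its input being $u_0=\tau_0\dot a_0+a_0$). Suppose that for this leader motion the cooperation objective holds from all initial states of the followers, i.e. along every closed-loop trajectory $$\lim_{t\to\infty}|v_i(t)-v_0(t)|=0,\qquad \lim_{t\to\infty}|p_i(t)-p_{i-1}(t)+d_0|=0,\qquad i=1,\dots,N.$$ Then: 1. In steady state the leader must move at constant speed: there are $b,v\in\mathbb R$ with $p_0(t)-(b+vt)\to0$, $v_0(t)\to v$ and $a_0(t)\to0$ as $t\to\infty$. If moreover the leader has no decaying modes, i.e. $\sigma(S)$ lies in the closed right half-plane, then it moves exactly at constant speed: $\dot p_0=v_0$ and $\dot v_0=0$ on $[0,\infty)$. 2. The spacing must be measured: $c_p=1$. -/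

import Mathlib

open Filter Topology Set

noncomputable section

/-- System matrix of the third-order longitudinal model `p' = v`, `v' = a`, `τ a' + a = u`,
for the state `(p, v, a)`. -/
def vehA (τ : ℝ) : Matrix (Fin 3) (Fin 3) ℝ :=
  !![0, 1, 0;
     0, 0, 1;
     0, 0, -(1 / τ)]

/-- Input vector of the third-order longitudinal model. -/
def vehB (τ : ℝ) : Fin 3 → ℝ := ![0, 0, 1 / τ]

/-- Data of a platoon with leader `0` and followers `1, …, N` (follower `i` is `i.succ` for
`i : Fin N`). -/
structure Platoon (N : ℕ) where
  /-- inertial time lags of all vehicles, the leader included -/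
  τ : Fin (N + 1) → ℝ
  τ_pos : ∀ i, 0 < τ i
  /-- measurement flags `c_p, c_v, c_a` -/
  c : Fin 3 → ℝ
  c_zero_or_one : ∀ l, c l = 0 ∨ c l = 1
  /-- information flow among followers: `G.Adj j i` means that `i` obtains information of `j` -/
  G : Digraph (Fin N)
  no_loop : ∀ i, ¬ G.Adj i i
  /-- the followers that obtain information of the leader -/
  pinned : Set (Fin N)
  /-- feedback gains `(k_p, k_v, k_a)` of the followers -/
  k : Fin N → Fin 3 → ℝ
  /-- desired gap -/
  d₀ : ℝ

namespace Platoon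

variable {N : ℕ} (P : Platoon N)

/-- Output matrix `C = diag(c_p, c_v, c_a)`. -/
def C : Matrix (Fin 3) (Fin 3) ℝ := Matrix.diagonal P.c

open Classical in
/-- Adjacency matrix: `a i j = 1` if follower `i` obtains the information of follower `j`. -/
def adj : Matrix (Fin N) (Fin N) ℝ := Matrix.of fun i j => if P.G.Adj j i then 1 else 0

open Classical in
/-- Diagonal entries of the pinning matrix. -/
def pin (i : Fin N) : ℝ := if i ∈ P.pinned then 1 else 0

/-- Desired displacement of vehicle `i` relative to vehicle `j`; the vehicle with the larger index
drives behind. -/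
def dHat (i j : Fin (N + 1)) : Fin 3 → ℝ :=
  ![-((((i : ℕ) : ℝ) - ((j : ℕ) : ℝ)) * P.d₀), 0, 0]

/-- Static diffusive controller of follower `i`, evaluated at the states `X` of all vehicles. -/
def control (i : Fin N) (X : Fin (N + 1) → Fin 3 → ℝ) : ℝ :=
  -(P.k i ⬝ᵥ ∑ j : Fin N, P.adj i j •
      (P.C.mulVec (X i.succ) - P.C.mulVec (X j.succ) - P.dHat i.succ j.succ))
    - P.pin i * (P.k i ⬝ᵥ
      (P.C.mulVec (X i.succ) - P.C.mulVec (X 0) - P.dHat i.succ 0))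

/-- `x₀` is a motion `(p₀, v₀, a₀)` of the leading vehicle on `[0, ∞)`: it obeys the vehicle
dynamics for some input, and it is generated by the autonomous linear system `w' = S w`,
`x₀ = H w`. -/
def IsLeaderMotion {m : ℕ} (S : Matrix (Fin m) (Fin m) ℝ) (H : Matrix (Fin 3) (Fin m) ℝ)
    (x₀ : ℝ → Fin 3 → ℝ) : Prop :=
  (∃ u₀ : ℝ → ℝ, ∀ t, 0 ≤ t →
    HasDerivWithinAt x₀ ((vehA (P.τ 0)).mulVec (x₀ t) + u₀ t • vehB (P.τ 0)) (Ici 0) t) ∧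
  ∃ w : ℝ → Fin m → ℝ, ∀ t, 0 ≤ t →
    HasDerivWithinAt w (S.mulVec (w t)) (Ici 0) t ∧ x₀ t = H.mulVec (w t)

/-- `x t i` is the state of vehicle `i` at time `t`; the leader performs the motion `x₀`, and each
follower obeys the vehicle dynamics under its feedback controller. -/
def IsClosedLoopTrajectory (x₀ : ℝ → Fin 3 → ℝ) (x : ℝ → Fin (N + 1) → Fin 3 → ℝ) : Prop :=
  (∀ t, 0 ≤ t → x t 0 = x₀ t) ∧
  ∀ i : Fin N, ∀ t, 0 ≤ t →
    HasDerivWithinAt (fun s => x s i.succ)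
      ((vehA (P.τ i.succ)).mulVec (x t i.succ) + P.control i (x t) • vehB (P.τ i.succ)) (Ici 0) t

/-- The cooperation objective along one trajectory (constant spacing policy): every follower
asymptotically attains the leader's velocity and the gap `d₀` to its predecessor. -/
def Cooperates (x : ℝ → Fin (N + 1) → Fin 3 → ℝ) : Prop :=
  ∀ i : Fin N,
    Tendsto (fun t => ‖x t i.succ 1 - x t 0 1‖) atTop (𝓝 0) ∧
    Tendsto (fun t => ‖x t i.succ 0 - x t i.castSucc 0 - (-P.d₀)‖) atTop (𝓝 0)

/-- With the leader motion `x₀`, the closed loop achieves the cooperation objective from all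
initial states of the followers. -/
def AchievesObjective (x₀ : ℝ → Fin 3 → ℝ) : Prop :=
  ∀ x : ℝ → Fin (N + 1) → Fin 3 → ℝ, P.IsClosedLoopTrajectory x₀ x → P.Cooperates x

end Platoon

/-- No eigenvalue of the real matrix `S` lies in the open left half-plane. -/
def SpectrumInClosedRightHalfPlane {m : ℕ} (S : Matrix (Fin m) (Fin m) ℝ) : Prop :=
  ∀ z ∈ spectrum ℂ (S.map (algebraMap ℝ ℂ)), 0 ≤ z.re

end

/-!
The closed loop, the system `w' = S w` that generates the leader and a constant coordinate for the
desired displacements form one linear autonomous system (`Platoon.closedLoop`). A matrix exponential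
therefore supplies a closed-loop trajectory whose coordinates on `[0, ∞)` are outputs
`t ↦ φ (exp (t L) z)`
of that system.

If the spacing is not measured, displacing all followers by the same distance yields another
closed-loop trajectory, and the objective cannot hold along both (`Platoon.spacing_measured`).

Along a trajectory that meets the objective, the velocity differences vanish in the limit. The
outputs of a linear autonomous system form a finite-dimensional space invariant under time shifts,
and so do the vanishing ones among them; such a space is closed under differentiation
(`IsShiftSpace.deriv_mem`). Hence the acceleration differences vanish too, and, the spacing being
measured, all arguments of the controllers and the control inputs themselves vanish
(`Platoon.tendsto_control`). The lag `τ a' + a = u` then forces the acceleration of a follower, and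
with it that of the leader, to `0` (`tendsto_zero_of_lag`).

On the vanishing outputs differentiation is injective, hence bijective, so that the leader's
acceleration has a vanishing second antiderivative (`IsShiftSpace.exists_antideriv`); this is the
deviation of the leader from a motion at constant speed. Moreover every eigenvalue of
differentiation on that space belongs to the spectrum of the system and has negative real part.
Without such spectrum the space is trivial, and the acceleration is identically zero
(`output_eq_zero_of_tendsto`).
-/

noncomputable section

/-! ### Shift-invariant function spaces -/

/-- A finite-dimensional space of scalar functions of time that is invariant under all time shifts
and consists of differentiable functions. The outputs of a linear autonomous system form such a
space. -/
structure IsShiftSpace {𝕜 : Type*} [RCLike 𝕜] (V : Submodule 𝕜 (ℝ → 𝕜)) : Prop where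
  finite : FiniteDimensional 𝕜 V
  differentiable : ∀ f ∈ V, Differentiable ℝ f
  shift_mem : ∀ f ∈ V, ∀ s : ℝ, (fun t => f (t + s)) ∈ V

/-- The scalar functions that tend to `0` at `+∞`. -/
def vanishingAtTop (𝕜 : Type*) [RCLike 𝕜] : Submodule 𝕜 (ℝ → 𝕜) where
  carrier := {f | Tendsto f atTop (𝓝 0)}
  add_mem' {f g} hf hg := by
    have h : Tendsto (f + g) atTop (𝓝 (0 + 0)) := Tendsto.add hf hg
    rwa [add_zero] at h
  zero_mem' := tendsto_const_nhds
  smul_mem' c f hf := by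
    have h : Tendsto (c • f) atTop (𝓝 (c • 0)) := Tendsto.const_smul hf c
    rwa [smul_zero] at h

namespace IsShiftSpace

variable {𝕜 : Type*} [RCLike 𝕜] {V : Submodule 𝕜 (ℝ → 𝕜)}

/-- The derivative is the pointwise limit of the difference quotients, which lie in `V`, and a
finite-dimensional subspace is closed in the topology of pointwise convergence. -/
theorem deriv_mem (hV : IsShiftSpace V) {f : ℝ → 𝕜} (hf : f ∈ V) : deriv f ∈ V := by
  have := hV.finite
  have hclosed : IsClosed (V : Set (ℝ → 𝕜)) := V.closed_of_finiteDimensional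
  refine hclosed.mem_of_tendsto (b := 𝓝[≠] (0 : ℝ))
    (f := fun s t => s⁻¹ • (f (t + s) - f t)) ?_ ?_
  · rw [tendsto_pi_nhds]
    intro t
    exact hasDerivAt_iff_tendsto_slope_zero.1 (hV.differentiable f hf t).hasDerivAt
  · refine Eventually.of_forall fun s => ?_
    have h := V.smul_mem ((s⁻¹ : ℝ) : 𝕜) (V.sub_mem (hV.shift_mem f hf s) hf)
    convert! h using 1
    funext t
    simp [RCLike.real_smul_eq_coe_mul]

theorem inf_vanishing (hV : IsShiftSpace V) : IsShiftSpace (V ⊓ vanishingAtTop 𝕜) where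
  finite := by
    have := hV.finite
    exact Submodule.finiteDimensional_inf_left _ _
  differentiable f hf := hV.differentiable f hf.1
  shift_mem f hf s := ⟨hV.shift_mem f hf.1 s, hf.2.comp (tendsto_atTop_add_const_right _ s tendsto_id)⟩

/-- For functions in a shift space, unlike for general smooth functions, convergence to `0` passes
to the derivative. -/
theorem tendsto_deriv (hV : IsShiftSpace V) {f : ℝ → 𝕜} (hf : f ∈ V)
    (h0 : Tendsto f atTop (𝓝 0)) : Tendsto (deriv f) atTop (𝓝 0) :=
  (hV.inf_vanishing.deriv_mem ⟨hf, h0⟩).2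

/-- Differentiation as an endomorphism of a shift space. -/
def derivEnd (hV : IsShiftSpace V) : Module.End 𝕜 V where
  toFun f := ⟨deriv f.1, hV.deriv_mem f.2⟩
  map_add' f g := by
    ext t
    exact deriv_add (hV.differentiable f f.2 t) (hV.differentiable g g.2 t)
  map_smul' c f := by
    ext t
    exact deriv_const_smul c (hV.differentiable f f.2 t)

/-- A function of a shift space that vanishes at `+∞` has an antiderivative of the same kind:
differentiation is injective on the vanishing functions, since nonzero constants do not vanish,
hence surjective by finite dimension. -/
theorem exists_antideriv (hV : IsShiftSpace V) {f : ℝ → 𝕜} (hf : f ∈ V)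
    (h0 : Tendsto f atTop (𝓝 0)) :
    ∃ q ∈ V, Tendsto q atTop (𝓝 0) ∧ ∀ t, HasDerivAt q (f t) t := by
  have hV0 := hV.inf_vanishing
  have := hV0.finite
  have hinj : Function.Injective hV0.derivEnd := by
    rw [injective_iff_map_eq_zero]
    intro g hg
    have hd : ∀ t, deriv g.1 t = 0 := fun t => congrFun (congrArg Subtype.val hg) t
    have hc : g.1 = fun _ => g.1 0 :=
      funext fun t => is_const_of_deriv_eq_zero (hV0.differentiable g g.2) hd t 0
    have hlim : Tendsto (fun _ : ℝ => g.1 0) atTop (𝓝 0) := hc ▸ g.2.2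
    have : g.1 0 = 0 := tendsto_nhds_unique tendsto_const_nhds hlim
    ext t
    rw [hc, this]
    rfl
  obtain ⟨q, hq⟩ := LinearMap.surjective_of_injective hinj ⟨f, hf, h0⟩
  refine ⟨q.1, q.2.1, q.2.2, fun t => ?_⟩
  have : deriv q.1 t = f t := congrFun (congrArg Subtype.val hq) t
  exact this ▸ (hV0.differentiable q q.2 t).hasDerivAt

end IsShiftSpace

/-! ### Outputs of linear autonomous systems -/

section LinearSystem

variable {𝕜 : Type*} [RCLike 𝕜] {E : Type*} [NormedAddCommGroup E] [NormedSpace 𝕜 E]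

/-- The solution of `y' = L y` with `y 0 = z`. -/
def flow (L : E →L[𝕜] E) (z : E) (t : ℝ) : E := NormedSpace.exp ((t : 𝕜) • L) z

theorem flow_zero (L : E →L[𝕜] E) (z : E) : flow L z 0 = z := by
  simp [flow]

theorem flow_apply_comm (L : E →L[𝕜] E) (z : E) (t : ℝ) :
    L (flow L z t) = flow L (L z) t := by
  have h : Commute L (NormedSpace.exp ((t : 𝕜) • L)) :=
    ((Commute.refl L).smul_right _).exp_right
  exact congrArg (fun T : E →L[𝕜] E => T z) h.eq

variable [FiniteDimensional 𝕜 E]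

theorem flow_add (L : E →L[𝕜] E) (z : E) (t s : ℝ) :
    flow L z (t + s) = flow L (flow L z s) t := by
  have := FiniteDimensional.complete 𝕜 E
  have h : Commute ((t : 𝕜) • L) ((s : 𝕜) • L) :=
    ((Commute.refl L).smul_right _).smul_left _
  let _ := NormedAlgebra.restrictScalars ℚ 𝕜 (E →L[𝕜] E)
  have := NormedSpace.exp_add_of_commute (𝔸 := E →L[𝕜] E) h
  simp only [flow, RCLike.ofReal_add, add_smul, this]
  rfl

variable [NormedSpace ℝ E] [IsScalarTower ℝ 𝕜 E]

theorem hasDerivAt_flow (L : E →L[𝕜] E) (z : E) (t : ℝ) :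
    HasDerivAt (flow L z) (L (flow L z t)) t := by
  have := FiniteDimensional.complete 𝕜 E
  have h := (hasDerivAt_exp_smul_const' (𝕂 := 𝕜) L (t : 𝕜)).clm_apply (hasDerivAt_const (t : 𝕜) z)
  have h2 := h.scomp t (RCLike.ofRealCLM (K := 𝕜)).hasDerivAt
  convert! h2 using 1
  simp [flow]

theorem eq_flow (L : E →L[𝕜] E) {w : ℝ → E}
    (hw : ∀ t, 0 ≤ t → HasDerivWithinAt w (L (w t)) (Ici 0) t) {t : ℝ} (ht : 0 ≤ t) :
    w t = flow L (w 0) t := by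
  refine ODE_solution_unique (v := fun _ => L) (K := ‖L‖₊) (a := 0) (b := t)
    (fun _ => L.lipschitz) ?_ ?_ ?_ ?_ (flow_zero L _).symm (right_mem_Icc.2 ht)
  · exact fun s hs => (hw s hs.1).continuousWithinAt.mono Icc_subset_Ici_self
  · exact fun s hs => (hw s hs.1).mono (Ici_subset_Ici.2 hs.1)
  · exact fun s _ => (hasDerivAt_flow L _ s).continuousAt.continuousWithinAt
  · exact fun s _ => (hasDerivAt_flow L _ s).hasDerivWithinAt

/-- The output functions `t ↦ φ (exp (t L) z)` as a linear function of the initial state `z`. -/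
def outputMap (L : E →L[𝕜] E) (φ : E →ₗ[𝕜] 𝕜) : E →ₗ[𝕜] (ℝ → 𝕜) where
  toFun z t := φ (flow L z t)
  map_add' z z' := by ext t; simp [flow]
  map_smul' c z := by ext t; simp [flow]

theorem hasDerivAt_outputMap (L : E →L[𝕜] E) (φ : E →ₗ[𝕜] 𝕜) (z : E) (t : ℝ) :
    HasDerivAt (outputMap L φ z) (outputMap L φ (L z) t) t := by
  have h := (φ.toContinuousLinearMap.restrictScalars ℝ).hasFDerivAt.comp_hasDerivAt t
    (hasDerivAt_flow L z t)
  rw [flow_apply_comm] at h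
  exact h

theorem isShiftSpace_range_outputMap (L : E →L[𝕜] E) (φ : E →ₗ[𝕜] 𝕜) :
    IsShiftSpace (LinearMap.range (outputMap L φ)) where
  finite := inferInstance
  differentiable := by
    rintro _ ⟨z, rfl⟩ t
    exact (hasDerivAt_outputMap L φ z t).differentiableAt
  shift_mem := by
    rintro _ ⟨z, rfl⟩ s
    refine ⟨flow L z s, ?_⟩
    ext t
    exact congrArg φ (flow_add L z t s).symm

end LinearSystem

/-- A linear autonomous system without spectrum in the open left half-plane has no nonzero output
that vanishes at `+∞`. Otherwise differentiation has an eigenfunction `t ↦ c * exp (μ t)` among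
the vanishing outputs; there `re μ < 0`, so `L - μ` is invertible, which makes `d/dt - μ`
surjective, hence injective, on the space of all outputs. -/
theorem output_eq_zero_of_tendsto {E : Type*} [NormedAddCommGroup E] [NormedSpace ℂ E]
    [FiniteDimensional ℂ E] (L : E →L[ℂ] E) (φ : E →ₗ[ℂ] ℂ)
    (hL : ∀ μ : ℂ, μ.re < 0 → Function.Surjective fun z => L z - μ • z) (z : E)
    (h0 : Tendsto (outputMap L φ z) atTop (𝓝 0)) : outputMap L φ z = 0 := by
  have hV := isShiftSpace_range_outputMap L φ
  have hV0 := hV.inf_vanishing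
  have := hV.finite
  have := hV0.finite
  by_contra hne
  have : Nontrivial ↥(LinearMap.range (outputMap L φ) ⊓ vanishingAtTop ℂ) :=
    ⟨⟨⟨_, ⟨z, rfl⟩, h0⟩, 0, fun h => hne (congrArg Subtype.val h)⟩⟩
  obtain ⟨μ, hμ⟩ := Module.End.exists_eigenvalue hV0.derivEnd
  obtain ⟨g, hg⟩ := hμ.exists_hasEigenvector
  have hg0 : g.1 ≠ 0 := fun h => hg.2 (Subtype.ext h)
  have hgd : ∀ t, deriv g.1 t = μ * g.1 t := fun t =>
    congrFun (congrArg Subtype.val hg.apply_eq_smul) t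
  have hgD : ∀ t, HasDerivAt g.1 (μ * g.1 t) t := fun t =>
    hgd t ▸ (hV0.differentiable g g.2 t).hasDerivAt
  have hexp : ∀ t : ℝ, HasDerivAt (fun s : ℝ => Complex.exp (-(μ * s)))
      (-μ * Complex.exp (-(μ * t))) t := by
    intro t
    have h := (((hasDerivAt_id' t).ofReal_comp.const_mul μ).fun_neg).cexp
    convert h using 1
    push_cast
    ring
  have hconst : ∀ t : ℝ, g.1 t * Complex.exp (-(μ * t)) = g.1 0 := by
    intro t
    have h := is_const_of_deriv_eq_zero (f := fun s : ℝ => g.1 s * Complex.exp (-(μ * s)))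
      (fun s => ((hgD s).fun_mul (hexp s)).differentiableAt)
      (fun s => by rw [((hgD s).fun_mul (hexp s)).deriv]; ring) t 0
    simpa using h
  have hμre : μ.re < 0 := by
    by_contra hre
    push Not at hre
    have hle : ∀ᶠ t : ℝ in atTop, ‖g.1 0‖ ≤ ‖g.1 t‖ := by
      filter_upwards [eventually_ge_atTop 0] with t ht
      rw [← hconst t, norm_mul, Complex.norm_exp]
      refine mul_le_of_le_one_right (norm_nonneg _) (Real.exp_le_one_iff.2 ?_)
      simpa using mul_nonneg hre ht
    have hz : ‖g.1 0‖ ≤ 0 := by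
      have hlim : Tendsto (fun t => ‖g.1 t‖) atTop (𝓝 0) := by simpa using Tendsto.norm g.2.2
      exact ge_of_tendsto hlim hle
    refine hg0 (funext fun t => ?_)
    have h := hconst t
    rw [norm_le_zero_iff.1 hz] at h
    exact (mul_eq_zero.1 h).resolve_right (Complex.exp_ne_zero _)
  let T : Module.End ℂ (LinearMap.range (outputMap L φ)) := hV.derivEnd - μ • 1
  have hsurj : Function.Surjective T := by
    rintro ⟨_, y, rfl⟩
    obtain ⟨y', rfl⟩ := hL μ hμre y
    refine ⟨⟨_, y', rfl⟩, Subtype.ext (funext fun t => ?_)⟩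
    have h1 : deriv (outputMap L φ y') t = outputMap L φ (L y') t :=
      (hasDerivAt_outputMap L φ y' t).deriv
    simp only [map_sub, map_smul]
    exact congrArg (fun c : ℂ => c - μ • outputMap L φ y' t) h1
  have hinj : Function.Injective T := LinearMap.injective_iff_surjective.2 hsurj
  have hker : T ⟨g.1, g.2.1⟩ = 0 := by
    refine Subtype.ext (funext fun t => ?_)
    exact sub_eq_zero.2 (hgd t)
  have hzero := hinj (hker.trans (map_zero _).symm)
  exact hg0 (congrArg Subtype.val hzero)

/-! ### Differential relations on the half-line -/

theorem eq_of_hasDerivWithinAt_zero {F : Type*} [NormedAddCommGroup F] [NormedSpace ℝ F]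
    {f : ℝ → F} (hf : ∀ t, 0 ≤ t → HasDerivWithinAt f 0 (Ici 0) t) {t : ℝ} (ht : 0 ≤ t) :
    f t = f 0 :=
  constant_of_has_deriv_right_zero (b := t)
    (fun s hs => (hf s hs.1).continuousWithinAt.mono Icc_subset_Ici_self)
    (fun s hs => (hf s hs.1).mono (Ici_subset_Ici.2 hs.1)) t (right_mem_Icc.2 ht)

/-- One half of the next lemma, which applies it to `a` and to `-a`. -/
theorem eventually_lt_of_lag {τ : ℝ} (hτ : 0 < τ) {a u : ℝ → ℝ}
    (ha : ∀ t, 0 ≤ t → HasDerivWithinAt a (1 / τ * (u t - a t)) (Ici 0) t)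
    (hu : Tendsto u atTop (𝓝 0)) {ε : ℝ} (hε : 0 < ε) : ∀ᶠ t in atTop, a t < ε := by
  obtain ⟨T, hT0, hT⟩ : ∃ T, 0 ≤ T ∧ ∀ t ≥ T, u t < ε / 2 := by
    obtain ⟨T, hT⟩ := eventually_atTop.1 (hu.eventually_lt_const (half_pos hε))
    exact ⟨max T 0, le_max_right _ _, fun t ht => hT t (le_trans (le_max_left _ _) ht)⟩
  have hexp : ∀ t : ℝ, HasDerivAt (fun s : ℝ => Real.exp (s / τ)) (Real.exp (t / τ) * (1 / τ)) t :=
    fun t => ((hasDerivAt_id t).div_const τ).exp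
  have hder : ∀ t, 0 ≤ t → HasDerivWithinAt (fun s => Real.exp (s / τ) * (a s - ε / 2))
      (Real.exp (t / τ) * (1 / τ) * (a t - ε / 2) +
        Real.exp (t / τ) * (1 / τ * (u t - a t))) (Ici 0) t := fun t ht =>
    (hexp t).hasDerivWithinAt.mul ((ha t ht).sub_const (ε / 2))
  have hanti : AntitoneOn (fun s => Real.exp (s / τ) * (a s - ε / 2)) (Ici T) := by
    refine antitoneOn_of_hasDerivWithinAt_nonpos (convex_Ici T)
      (fun t ht => ((hder t (hT0.trans ht)).continuousWithinAt.mono (Ici_subset_Ici.2 hT0)))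
      (fun t ht => (hder t (hT0.trans (interior_subset ht))).mono
        (interior_subset.trans (Ici_subset_Ici.2 hT0))) (fun t ht => ?_)
    have h1 : 0 < Real.exp (t / τ) * (1 / τ) := by positivity
    have h2 := hT t (interior_subset ht)
    nlinarith
  have hlim : Tendsto (fun t : ℝ => Real.exp (T / τ) * (a T - ε / 2) * Real.exp (-(t / τ)))
      atTop (𝓝 0) := by
    have h := (Real.tendsto_exp_neg_atTop_nhds_zero.comp (tendsto_id.atTop_div_const hτ)).const_mul
      (Real.exp (T / τ) * (a T - ε / 2))
    simpa using h
  filter_upwards [hlim.eventually_lt_const (half_pos hε), eventually_ge_atTop T] with t h1 h2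
  have h3 : Real.exp (t / τ) * (a t - ε / 2) ≤ Real.exp (T / τ) * (a T - ε / 2) :=
    hanti self_mem_Ici h2 h2
  have h4 : a t - ε / 2 ≤ Real.exp (T / τ) * (a T - ε / 2) * Real.exp (-(t / τ)) := by
    rw [Real.exp_neg, ← div_eq_mul_inv, le_div_iff₀ (Real.exp_pos _)]
    linarith
  linarith

/-- A first-order lag `τ a' + a = u` driven by a vanishing input has a vanishing output. -/
theorem tendsto_zero_of_lag {τ : ℝ} (hτ : 0 < τ) {a u : ℝ → ℝ}
    (ha : ∀ t, 0 ≤ t → HasDerivWithinAt a (1 / τ * (u t - a t)) (Ici 0) t)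
    (hu : Tendsto u atTop (𝓝 0)) : Tendsto a atTop (𝓝 0) := by
  have hneg : ∀ t, 0 ≤ t →
      HasDerivWithinAt (fun s => -a s) (1 / τ * (-u t - -a t)) (Ici 0) t := fun t ht => by
    exact (ha t ht).fun_neg.congr_deriv (by ring)
  have hu' : Tendsto (fun t => -u t) atTop (𝓝 0) := by simpa using hu.neg
  refine tendsto_order.2 ⟨fun b hb => ?_, fun b hb => eventually_lt_of_lag hτ ha hu hb⟩
  filter_upwards [eventually_lt_of_lag hτ hneg hu' (neg_pos.2 hb)] with t ht
  linarith

/-! ### The closed loop of a platoon -/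

namespace Platoon

variable {N : ℕ} (P : Platoon N)

theorem control_congr (i : Fin N) {X Y : Fin (N + 1) → Fin 3 → ℝ}
    (h : ∀ j, P.C.mulVec (X j) = P.C.mulVec (Y j)) : P.control i X = P.control i Y := by
  simp only [control, h]

theorem dHat_sub_dHat_zero (i j : Fin (N + 1)) : P.dHat i 0 - P.dHat j 0 = P.dHat i j := by
  ext l
  fin_cases l <;> simp [dHat]
  ring

/-- The controller with the constant displacements scaled by `s`, which makes it jointly linear in
the leader state `q`, the follower states `X` and `s`. -/
def scaledControl (i : Fin N) (q : Fin 3 → ℝ) (X : Fin N → Fin 3 → ℝ) (s : ℝ) : ℝ :=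
  -(P.k i ⬝ᵥ ∑ j : Fin N, P.adj i j •
      (P.C.mulVec (X i) - P.C.mulVec (X j) - s • P.dHat i.succ j.succ))
    - P.pin i * (P.k i ⬝ᵥ (P.C.mulVec (X i) - P.C.mulVec q - s • P.dHat i.succ 0))

theorem scaledControl_one (i : Fin N) (q : Fin 3 → ℝ) (X : Fin N → Fin 3 → ℝ) :
    P.scaledControl i q X 1 = P.control i (Fin.cons q X : Fin (N + 1) → Fin 3 → ℝ) := by
  simp [scaledControl, control]

theorem scaledControl_add (i : Fin N) (q q' : Fin 3 → ℝ) (X X' : Fin N → Fin 3 → ℝ) (s s' : ℝ) :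
    P.scaledControl i (q + q') (X + X') (s + s') =
      P.scaledControl i q X s + P.scaledControl i q' X' s' := by
  have h : ∀ (a a' b b' : Fin 3 → ℝ) (d : Fin 3 → ℝ),
      P.C.mulVec (a + a') - P.C.mulVec (b + b') - (s + s') • d =
        (P.C.mulVec a - P.C.mulVec b - s • d) + (P.C.mulVec a' - P.C.mulVec b' - s' • d) := by
    intro a a' b b' d
    simp only [Matrix.mulVec_add, add_smul]
    abel
  simp only [scaledControl, Pi.add_apply, h, smul_add, Finset.sum_add_distrib, dotProduct_add]
  ring

theorem scaledControl_smul (i : Fin N) (r : ℝ) (q : Fin 3 → ℝ) (X : Fin N → Fin 3 → ℝ) (s : ℝ) :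
    P.scaledControl i (r • q) (r • X) (r * s) = r * P.scaledControl i q X s := by
  have h : ∀ (a b : Fin 3 → ℝ) (d : Fin 3 → ℝ),
      P.C.mulVec (r • a) - P.C.mulVec (r • b) - (r * s) • d =
        r • (P.C.mulVec a - P.C.mulVec b - s • d) := by
    intro a b d
    simp only [Matrix.mulVec_smul, mul_smul, smul_sub]
  have h' : ∀ (c : ℝ) (v : Fin 3 → ℝ), c • r • v = r • c • v := fun c v => smul_comm c r v
  simp only [scaledControl, Pi.smul_apply, h, h', ← Finset.smul_sum, dotProduct_smul, smul_eq_mul]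
  ring

/-- The closed loop together with the system `w' = S w` generating the leader and a constant
coordinate for the desired displacements, as one linear autonomous system on `(w, X, s)`. -/
def closedLoop {m : ℕ} (S : Matrix (Fin m) (Fin m) ℝ) (H : Matrix (Fin 3) (Fin m) ℝ) :
    ((Fin m → ℝ) × (Fin N → Fin 3 → ℝ) × ℝ) →L[ℝ] ((Fin m → ℝ) × (Fin N → Fin 3 → ℝ) × ℝ) :=
  LinearMap.toContinuousLinearMap
    { toFun := fun y => (S.mulVec y.1, fun i => (vehA (P.τ i.succ)).mulVec (y.2.1 i) +
        P.scaledControl i (H.mulVec y.1) y.2.1 y.2.2 • vehB (P.τ i.succ), 0)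
      map_add' := fun y y' => by
        refine Prod.ext (Matrix.mulVec_add S y.1 y'.1) (Prod.ext (funext fun i => ?_) (by simp))
        simp only [Prod.fst_add, Prod.snd_add, Matrix.mulVec_add, scaledControl_add, Pi.add_apply,
          add_smul]
        abel
      map_smul' := fun r y => by
        refine Prod.ext (Matrix.mulVec_smul S r y.1) (Prod.ext (funext fun i => ?_) (by simp))
        simp only [Prod.smul_fst, Prod.smul_snd, Matrix.mulVec_smul, smul_eq_mul,
          scaledControl_smul, Pi.smul_apply, mul_smul, smul_add, RingHom.id_apply] }

theorem closedLoop_apply {m : ℕ} (S : Matrix (Fin m) (Fin m) ℝ) (H : Matrix (Fin 3) (Fin m) ℝ)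
    (y : (Fin m → ℝ) × (Fin N → Fin 3 → ℝ) × ℝ) :
    P.closedLoop S H y = (S.mulVec y.1, fun i => (vehA (P.τ i.succ)).mulVec (y.2.1 i) +
        P.scaledControl i (H.mulVec y.1) y.2.1 y.2.2 • vehB (P.τ i.succ), 0) := rfl

/-- Every leader motion is accompanied by a closed-loop trajectory that is an output of a linear
autonomous system. -/
theorem exists_trajectory {m : ℕ} {S : Matrix (Fin m) (Fin m) ℝ} {H : Matrix (Fin 3) (Fin m) ℝ}
    {x₀ : ℝ → Fin 3 → ℝ} {w : ℝ → Fin m → ℝ}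
    (hw : ∀ t, 0 ≤ t → HasDerivWithinAt w (S.mulVec (w t)) (Ici 0) t ∧ x₀ t = H.mulVec (w t)) :
    ∃ y : ℝ → (Fin m → ℝ) × (Fin N → Fin 3 → ℝ) × ℝ,
      (∃ z, y = flow (𝕜 := ℝ) (P.closedLoop S H) z) ∧
      (∀ t, 0 ≤ t → x₀ t = H.mulVec (y t).1) ∧
      P.IsClosedLoopTrajectory x₀
        (fun t => (Fin.cons (x₀ t) (y t).2.1 : Fin (N + 1) → Fin 3 → ℝ)) := by
  let z : (Fin m → ℝ) × (Fin N → Fin 3 → ℝ) × ℝ := (w 0, 0, 1)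
  let y := flow (𝕜 := ℝ) (P.closedLoop S H) z
  have hy : ∀ t, HasDerivAt y (P.closedLoop S H (y t)) t := hasDerivAt_flow (𝕜 := ℝ) _ z
  have hy0 : y 0 = z := flow_zero (𝕜 := ℝ) _ z
  have hy1 : ∀ t, HasDerivAt (fun s => (y s).1) (S.mulVec (y t).1) t := fun t =>
    (hy t).fst
  have hyX : ∀ t, HasDerivAt (fun s => (y s).2.1) (P.closedLoop S H (y t)).2.1 t := fun t =>
    (hy t).snd.fst
  have hys : ∀ t, HasDerivAt (fun s => (y s).2.2) 0 t := fun t =>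
    (hy t).snd.snd
  have h2 : ∀ t, (y t).2.2 = 1 := fun t => by
    have h := is_const_of_deriv_eq_zero (fun s => (hys s).differentiableAt)
      (fun s => (hys s).deriv) t 0
    rw [h, hy0]
  have h1 : ∀ t, 0 ≤ t → (y t).1 = w t := fun t ht => by
    let LS : (Fin m → ℝ) →L[ℝ] (Fin m → ℝ) := LinearMap.toContinuousLinearMap S.mulVecLin
    have e1 := eq_flow (𝕜 := ℝ) LS (fun t _ => (hy1 t).hasDerivWithinAt) ht
    have e2 := eq_flow (𝕜 := ℝ) LS (fun t ht => (hw t ht).1) ht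
    rw [e1, e2, hy0]
  have hx : ∀ t, 0 ≤ t → x₀ t = H.mulVec (y t).1 := fun t ht => by
    rw [h1 t ht, (hw t ht).2]
  refine ⟨y, ⟨z, rfl⟩, hx, fun t _ => rfl, fun i t ht => ?_⟩
  have h := (hasDerivAt_pi.1 (hyX t) i).hasDerivWithinAt (s := Ici 0)
  simp only [closedLoop_apply, h2, scaledControl_one, ← hx t ht] at h
  exact h

/-- If the spacing is not measured, all followers can be displaced by the same distance without
the controllers noticing, so that the gap between the first follower and the leader cannot be
attained from all initial states. -/
theorem spacing_measured (hN : 1 ≤ N) {x₀ : ℝ → Fin 3 → ℝ} (hobj : P.AchievesObjective x₀)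
    {x : ℝ → Fin (N + 1) → Fin 3 → ℝ} (hx : P.IsClosedLoopTrajectory x₀ x) : P.c 0 = 1 := by
  refine (P.c_zero_or_one 0).resolve_left fun hc => ?_
  let e : Fin 3 → ℝ := ![1, 0, 0]
  have hCe : P.C.mulVec e = 0 := by
    ext l
    fin_cases l <;> simp [C, e, Matrix.mulVec_diagonal, hc]
  have hAe : ∀ τ, (vehA τ).mulVec e = 0 := fun τ => by
    ext l
    fin_cases l <;> simp [vehA, e, Matrix.mulVec, dotProduct, Fin.sum_univ_three]
  let x' : ℝ → Fin (N + 1) → Fin 3 → ℝ := fun t => Fin.cons (x t 0) fun i => x t i.succ + e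
  have hctrl : ∀ i t, P.control i (x' t) = P.control i (x t) := fun i t =>
    P.control_congr i fun j => by
      refine Fin.cases rfl (fun j => ?_) j
      simp [x', Matrix.mulVec_add, hCe]
  have hx' : P.IsClosedLoopTrajectory x₀ x' := by
    refine ⟨hx.1, fun i t ht => ?_⟩
    have h := (hx.2 i t ht).add_const e
    rw [hctrl]
    simpa [x', Matrix.mulVec_add, hAe] using h
  have h1 := tendsto_zero_iff_norm_tendsto_zero.2 (hobj x hx ⟨0, hN⟩).2
  have h2 := tendsto_zero_iff_norm_tendsto_zero.2 (hobj x' hx' ⟨0, hN⟩).2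
  have h3 := h2.sub h1
  have h4 : Tendsto (fun _ : ℝ => (1 : ℝ)) atTop (𝓝 (0 - 0)) := by
    refine h3.congr fun t => ?_
    have hs : x' t (Fin.succ ⟨0, hN⟩) 0 = x t (Fin.succ ⟨0, hN⟩) 0 + 1 := rfl
    have hp : x' t (Fin.castSucc ⟨0, hN⟩) 0 = x t (Fin.castSucc ⟨0, hN⟩) 0 := rfl
    rw [hs, hp]
    ring
  simpa using tendsto_nhds_unique tendsto_const_nhds h4

theorem hasDerivWithinAt_velocity {τ u t : ℝ} {x : ℝ → Fin 3 → ℝ}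
    (h : HasDerivWithinAt x ((vehA τ).mulVec (x t) + u • vehB τ) (Ici 0) t) :
    HasDerivWithinAt (fun s => x s 1) (x t 2) (Ici 0) t :=
  (hasDerivWithinAt_pi.1 h 1).congr_deriv (by
    simp [vehA, vehB, dotProduct, Fin.sum_univ_three])

theorem hasDerivWithinAt_position {τ u t : ℝ} {x : ℝ → Fin 3 → ℝ}
    (h : HasDerivWithinAt x ((vehA τ).mulVec (x t) + u • vehB τ) (Ici 0) t) :
    HasDerivWithinAt (fun s => x s 0) (x t 1) (Ici 0) t :=
  (hasDerivWithinAt_pi.1 h 0).congr_deriv (by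
    simp [vehA, vehB, dotProduct, Fin.sum_univ_three])

theorem hasDerivWithinAt_acceleration {τ u t : ℝ} {x : ℝ → Fin 3 → ℝ}
    (h : HasDerivWithinAt x ((vehA τ).mulVec (x t) + u • vehB τ) (Ici 0) t) :
    HasDerivWithinAt (fun s => x s 2) (1 / τ * (u - x t 2)) (Ici 0) t :=
  (hasDerivWithinAt_pi.1 h 2).congr_deriv (by
    simp [vehA, vehB, dotProduct, Fin.sum_univ_three]
    ring)

theorem Cooperates.tendsto_gap {P : Platoon N} {x : ℝ → Fin (N + 1) → Fin 3 → ℝ}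
    (hx : P.Cooperates x) (j : Fin (N + 1)) :
    Tendsto (fun t => x t j 0 - x t 0 0 - P.dHat j 0 0) atTop (𝓝 0) := by
  induction j using Fin.induction with
  | zero => simp [dHat]
  | succ i ih =>
    have h := (tendsto_zero_iff_norm_tendsto_zero.2 (hx i).2).add ih
    rw [add_zero] at h
    refine h.congr fun t => ?_
    simp [dHat]
    ring

theorem Cooperates.tendsto_velocity {P : Platoon N} {x : ℝ → Fin (N + 1) → Fin 3 → ℝ}
    (hx : P.Cooperates x) (j : Fin (N + 1)) :
    Tendsto (fun t => x t j 1 - x t 0 1) atTop (𝓝 0) := by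
  refine Fin.cases (by simp) (fun i => ?_) j
  exact tendsto_zero_iff_norm_tendsto_zero.2 (hx i).1

/-- With measured spacing the control errors of all vehicles vanish in the limit, hence so do the
control inputs. -/
theorem tendsto_control (hc : P.c 0 = 1) {x : ℝ → Fin (N + 1) → Fin 3 → ℝ}
    (hx : P.Cooperates x)
    (ha : ∀ j, Tendsto (fun t => x t j 2 - x t 0 2) atTop (𝓝 0)) (i : Fin N) :
    Tendsto (fun t => P.control i (x t)) atTop (𝓝 0) := by
  have hj : ∀ j, Tendsto (fun t => P.C.mulVec (x t j) - P.C.mulVec (x t 0) - P.dHat j 0)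
      atTop (𝓝 0) := by
    intro j
    rw [tendsto_pi_nhds]
    intro l
    fin_cases l
    · simpa [C, Matrix.mulVec_diagonal, hc] using hx.tendsto_gap j
    · simpa [C, Matrix.mulVec_diagonal, dHat, mul_sub] using (hx.tendsto_velocity j).const_mul (P.c 1)
    · simpa [C, Matrix.mulVec_diagonal, dHat, mul_sub] using (ha j).const_mul (P.c 2)
  have hij : ∀ j k, Tendsto (fun t => P.C.mulVec (x t j) - P.C.mulVec (x t k) - P.dHat j k)
      atTop (𝓝 0) := by
    intro j k
    have h := (hj j).sub (hj k)
    rw [sub_zero] at h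
    refine h.congr fun t => ?_
    rw [← P.dHat_sub_dHat_zero j k]
    abel
  have hdot : ∀ {f : ℝ → Fin 3 → ℝ}, Tendsto f atTop (𝓝 0) →
      Tendsto (fun t => P.k i ⬝ᵥ f t) atTop (𝓝 0) := by
    intro f hf
    have hcont : Continuous fun v : Fin 3 → ℝ => P.k i ⬝ᵥ v := by
      unfold dotProduct
      fun_prop
    have h := (hcont.tendsto 0).comp hf
    rwa [dotProduct_zero] at h
  have hsum : Tendsto (fun t => ∑ j : Fin N, P.adj i j •
      (P.C.mulVec (x t i.succ) - P.C.mulVec (x t j.succ) - P.dHat i.succ j.succ))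
      atTop (𝓝 0) := by
    simpa using tendsto_finsetSum Finset.univ
      fun j _ => (hij i.succ (Fin.succ j)).const_smul (P.adj i j)
  simpa [control] using (hdot hsum).neg.sub ((hdot (hij i.succ 0)).const_mul (P.pin i))

end Platoon

/-- If the velocity difference of two vehicles is an output of a linear autonomous system and
vanishes in the limit, then so does the difference of their accelerations. -/
theorem tendsto_deriv_output {E : Type*} [NormedAddCommGroup E] [NormedSpace ℝ E]
    [FiniteDimensional ℝ E] (L : E →L[ℝ] E) (φ : E →ₗ[ℝ] ℝ) (z : E) {f g : ℝ → ℝ}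
    (hf : ∀ t, 0 ≤ t → f t = outputMap (𝕜 := ℝ) L φ z t)
    (hfg : ∀ t, 0 ≤ t → HasDerivWithinAt f (g t) (Ici 0) t)
    (h0 : Tendsto f atTop (𝓝 0)) : Tendsto g atTop (𝓝 0) := by
  have h0' : Tendsto (outputMap (𝕜 := ℝ) L φ z) atTop (𝓝 0) :=
    h0.congr' ((eventually_ge_atTop 0).mono hf)
  refine ((isShiftSpace_range_outputMap (𝕜 := ℝ) L φ).tendsto_deriv ⟨z, rfl⟩ h0').congr' ?_
  filter_upwards [eventually_gt_atTop 0] with t ht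
  have hd := (hfg t ht.le).hasDerivAt (Ici_mem_nhds ht)
  have he : f =ᶠ[𝓝 t] outputMap (𝕜 := ℝ) L φ z := by
    filter_upwards [Ioi_mem_nhds ht] with s hs using hf s (le_of_lt hs)
  exact (hd.congr_of_eventuallyEq he.symm).deriv

/-! ### The motion of the leader -/

/-- A vanishing output of `w' = S w` is identically zero if `S` has no eigenvalue in the open left
half-plane. The statement is real; the system is complexified to have eigenvalues available. -/
theorem eq_zero_of_tendsto_of_spectrum {m : ℕ} {S : Matrix (Fin m) (Fin m) ℝ}
    (hS : SpectrumInClosedRightHalfPlane S) {w : ℝ → Fin m → ℝ}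
    (hw : ∀ t, 0 ≤ t → HasDerivWithinAt w (S.mulVec (w t)) (Ici 0) t) (h : Fin m → ℝ)
    (h0 : Tendsto (fun t => h ⬝ᵥ w t) atTop (𝓝 0)) {t : ℝ} (ht : 0 ≤ t) : h ⬝ᵥ w t = 0 := by
  let Sc : Matrix (Fin m) (Fin m) ℂ := S.map (algebraMap ℝ ℂ)
  let L : (Fin m → ℂ) →L[ℂ] (Fin m → ℂ) := LinearMap.toContinuousLinearMap Sc.mulVecLin
  let φ : (Fin m → ℂ) →ₗ[ℂ] ℂ :=
    { toFun := fun z => (fun j => (h j : ℂ)) ⬝ᵥ z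
      map_add' := dotProduct_add _
      map_smul' := fun c z => dotProduct_smul c _ z }
  let wc : ℝ → Fin m → ℂ := fun t j => (w t j : ℂ)
  have hwc : ∀ t, 0 ≤ t → HasDerivWithinAt wc (L (wc t)) (Ici 0) t := fun t ht => by
    refine hasDerivWithinAt_pi.2 fun j => ?_
    refine ((hasDerivWithinAt_pi.1 (hw t ht) j).ofReal_comp).congr_deriv ?_
    simp [L, Sc, wc, Matrix.mulVec, dotProduct]
  have hout : ∀ t, 0 ≤ t → ((h ⬝ᵥ w t : ℝ) : ℂ) = outputMap L φ (wc 0) t := fun t ht => by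
    have e : φ (wc t) = φ (flow L (wc 0) t) := congrArg φ (eq_flow L hwc ht)
    refine Eq.trans ?_ e
    simp [φ, wc, dotProduct]
  have hsurj : ∀ μ : ℂ, μ.re < 0 → Function.Surjective fun z => L z - μ • z := by
    intro μ hμ y
    have hunit : IsUnit (algebraMap ℂ (Matrix (Fin m) (Fin m) ℂ) μ - Sc) := by
      by_contra hn
      exact absurd (hS μ (spectrum.mem_iff.2 hn)) (not_le.2 hμ)
    obtain ⟨B, hB⟩ := hunit.exists_right_inv
    refine ⟨-(B.mulVec y), ?_⟩
    have h1 : (algebraMap ℂ (Matrix (Fin m) (Fin m) ℂ) μ - Sc).mulVec (B.mulVec y) = y := by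
      rw [Matrix.mulVec_mulVec, hB, Matrix.one_mulVec]
    rw [Matrix.sub_mulVec, Algebra.algebraMap_eq_smul_one, Matrix.smul_mulVec,
      Matrix.one_mulVec] at h1
    have h2 : L (B.mulVec y) = Sc.mulVec (B.mulVec y) := rfl
    simp only [map_neg, smul_neg, h2]
    rw [sub_neg_eq_add, neg_add_eq_sub]
    exact h1
  have hlim : Tendsto (outputMap L φ (wc 0)) atTop (𝓝 0) := by
    have h1 : Tendsto (fun t => ((h ⬝ᵥ w t : ℝ) : ℂ)) atTop (𝓝 ((0 : ℝ) : ℂ)) :=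
      (Complex.continuous_ofReal.tendsto 0).comp h0
    rw [Complex.ofReal_zero] at h1
    exact h1.congr' ((eventually_ge_atTop 0).mono hout)
  have hz := hout t ht
  rw [output_eq_zero_of_tendsto L φ hsurj _ hlim] at hz
  exact Complex.ofReal_eq_zero.1 hz

/-- A motion whose acceleration is a vanishing output of a linear autonomous system converges to a
motion at constant speed. -/
theorem exists_uniform_motion {E : Type*} [NormedAddCommGroup E] [NormedSpace ℝ E]
    [FiniteDimensional ℝ E] (L : E →L[ℝ] E) (φ : E →ₗ[ℝ] ℝ) (z : E) {p v a : ℝ → ℝ}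
    (hp : ∀ t, 0 ≤ t → HasDerivWithinAt p (v t) (Ici 0) t)
    (hv : ∀ t, 0 ≤ t → HasDerivWithinAt v (a t) (Ici 0) t)
    (ha : ∀ t, 0 ≤ t → a t = outputMap (𝕜 := ℝ) L φ z t) (h0 : Tendsto a atTop (𝓝 0)) :
    ∃ b c : ℝ, Tendsto (fun t => p t - (b + c * t)) atTop (𝓝 0) ∧
      Tendsto v atTop (𝓝 c) := by
  have hV := isShiftSpace_range_outputMap (𝕜 := ℝ) L φ
  have h0' : Tendsto (outputMap (𝕜 := ℝ) L φ z) atTop (𝓝 0) :=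
    h0.congr' ((eventually_ge_atTop 0).mono ha)
  obtain ⟨q, hqV, hq0, hq⟩ := hV.exists_antideriv ⟨z, rfl⟩ h0'
  obtain ⟨r, -, hr0, hr⟩ := hV.exists_antideriv hqV hq0
  have hvq : ∀ t, 0 ≤ t → v t - q t = v 0 - q 0 := fun t ht =>
    eq_of_hasDerivWithinAt_zero (f := fun s => v s - q s) (fun s hs =>
      ((hv s hs).fun_sub (hq s).hasDerivWithinAt).congr_deriv (sub_eq_zero.2 (ha s hs))) ht
  set c := v 0 - q 0
  have hpr : ∀ t, 0 ≤ t → p t - r t - c * t = p 0 - r 0 - c * 0 := fun t ht =>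
    eq_of_hasDerivWithinAt_zero (f := fun s => p s - r s - c * s) (fun s hs =>
      (((hp s hs).fun_sub (hr s).hasDerivWithinAt).fun_sub
        ((hasDerivAt_id' s).hasDerivWithinAt.const_mul c)).congr_deriv (by linarith [hvq s hs])) ht
  refine ⟨p 0 - r 0 - c * 0, c, hr0.congr' ?_, ?_⟩
  · filter_upwards [eventually_ge_atTop 0] with t ht
    linarith [hpr t ht]
  · have h := hq0.add_const c
    rw [zero_add] at h
    refine h.congr' ?_
    filter_upwards [eventually_ge_atTop 0] with t ht
    linarith [hvq t ht]

end

theorem theorem1 {N : ℕ} (hN : 1 ≤ N) (P : Platoon N)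
    {m : ℕ} (S : Matrix (Fin m) (Fin m) ℝ) (H : Matrix (Fin 3) (Fin m) ℝ)
    (x₀ : ℝ → Fin 3 → ℝ) (hx₀ : P.IsLeaderMotion S H x₀)
    (hobj : P.AchievesObjective x₀) :
    -- the steady state of the leader is a motion at constant speed
    (∃ b v : ℝ,
      Tendsto (fun t => x₀ t 0 - (b + v * t)) atTop (𝓝 0) ∧
      Tendsto (fun t => x₀ t 1) atTop (𝓝 v) ∧
      Tendsto (fun t => x₀ t 2) atTop (𝓝 0)) ∧
    -- a leader without transient modes moves exactly at constant speed
    (SpectrumInClosedRightHalfPlane S →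
      (∀ t, 0 ≤ t →
        HasDerivWithinAt (fun s => x₀ s 0) (x₀ t 1) (Ici 0) t ∧
        HasDerivWithinAt (fun s => x₀ s 1) 0 (Ici 0) t) ∧
      ∃ v : ℝ, ∀ t, 0 ≤ t → x₀ t 1 = v) ∧
    -- the spacing is measured
    P.c 0 = 1 := by
  obtain ⟨⟨u₀, hu₀⟩, w, hw⟩ := hx₀
  -- a single closed-loop trajectory suffices for everything that concerns the leader
  obtain ⟨y, ⟨z, hy⟩, hxy, htraj⟩ := P.exists_trajectory hw
  set x : ℝ → Fin (N + 1) → Fin 3 → ℝ := fun t => Fin.cons (x₀ t) (y t).2.1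
  have hcoop := hobj x htraj
  have hc := P.spacing_measured hN hobj htraj
  have hp₀ := fun t ht => Platoon.hasDerivWithinAt_position (hu₀ t ht)
  have hv₀ := fun t ht => Platoon.hasDerivWithinAt_velocity (hu₀ t ht)
  have ha : ∀ j, Tendsto (fun t => x t j 2 - x t 0 2) atTop (𝓝 0) := by
    refine Fin.cases (by simp) fun i => ?_
    let φ : ((Fin m → ℝ) × (Fin N → Fin 3 → ℝ) × ℝ) →ₗ[ℝ] ℝ :=
      { toFun := fun y => y.2.1 i 1 - H.mulVec y.1 1
        map_add' := fun y y' => by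
          simp only [Prod.fst_add, Prod.snd_add, Matrix.mulVec_add, Pi.add_apply]
          ring
        map_smul' := fun r y => by
          simp only [Prod.smul_fst, Prod.smul_snd, Matrix.mulVec_smul, Pi.smul_apply, smul_eq_mul,
            RingHom.id_apply]
          ring }
    refine tendsto_deriv_output (P.closedLoop S H) φ z (fun t ht => ?_) (fun t ht => ?_)
      (hcoop.tendsto_velocity i.succ)
    · change (y t).2.1 i 1 - x₀ t 1 = φ (flow (𝕜 := ℝ) (P.closedLoop S H) z t)
      rw [hxy t ht, hy]
      rfl
    · exact (Platoon.hasDerivWithinAt_velocity (htraj.2 i t ht)).fun_sub (hv₀ t ht)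
  have ha₀ : Tendsto (fun t => x₀ t 2) atTop (𝓝 0) := by
    -- the first follower is a lag driven by a vanishing input, and the leader copies it in the limit
    have h1 := tendsto_zero_of_lag (P.τ_pos (Fin.succ ⟨0, hN⟩))
      (fun t ht => Platoon.hasDerivWithinAt_acceleration (htraj.2 ⟨0, hN⟩ t ht))
      (P.tendsto_control hc hcoop ha ⟨0, hN⟩)
    have h2 := h1.sub (ha (Fin.succ ⟨0, hN⟩))
    rw [sub_zero] at h2
    exact h2.congr fun t => sub_sub_cancel _ _
  refine ⟨?_, fun hS => ?_, hc⟩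
  · let φ : ((Fin m → ℝ) × (Fin N → Fin 3 → ℝ) × ℝ) →ₗ[ℝ] ℝ :=
      LinearMap.proj 2 ∘ₗ H.mulVecLin ∘ₗ LinearMap.fst ℝ _ _
    obtain ⟨b, v, hb, hv⟩ := exists_uniform_motion (P.closedLoop S H) φ z hp₀ hv₀
      (fun t ht => by rw [hxy t ht, hy]; rfl) ha₀
    exact ⟨b, v, hb, hv, ha₀⟩
  · have hlim : Tendsto (fun t => H 2 ⬝ᵥ w t) atTop (𝓝 0) := by
      refine ha₀.congr' ?_
      filter_upwards [eventually_ge_atTop 0] with t ht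
      rw [(hw t ht).2]
      rfl
    have hz : ∀ t, 0 ≤ t → x₀ t 2 = 0 := fun t ht => by
      rw [(hw t ht).2]
      exact eq_zero_of_tendsto_of_spectrum hS (fun s hs => (hw s hs).1) (H 2) hlim ht
    have hv0 : ∀ t, 0 ≤ t → HasDerivWithinAt (fun s => x₀ s 1) 0 (Ici 0) t := fun t ht =>
      hz t ht ▸ hv₀ t ht
    exact ⟨fun t ht => ⟨hp₀ t ht, hv0 t ht⟩, x₀ 0 1, fun t ht =>
      eq_of_hasDerivWithinAt_zero hv0 ht⟩
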